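/- Let $d\ge 2$, let $B_1$ be the unit ball of $\mathbb{R}^d$, write $x=(x',x_d)\in\mathbb{R}^{d-1}\times\mathbb{R}$, and set $B_1^+=B_1\cap\{x_d>0\}$, $B_1'=B_1\cap\{x_d=0\}$. Let $g\in H^1(B_1^+)$ with $g\ge 0$ on $B_1'$, and let $$\mathcal K_{\rm th}=\{u\in H^1(B_1^+)\,:\ u\ge 0\ \text{on}\ B_1',\ u=g\ \text{on}\ \partial B_1\cap\{x_d>0\}\},$$ where values on $B_1'$ are understood in the sense of traces, and $u=g$ on $\partial B_1\cap\{x_d>0\}$ means that the extension of $u-g$ to $B_1$, even in $x_d$, belongs to $H^1_0(B_1)$. Extending the functions of $\mathcal K_{\rm th}$ evenly in $x_d$ to $B_1$, let $$\mathcal F_{\rm th}(u)=\frac12\int_{B_1}|\nabla u|^2\,dx,$$ and let $\varphi$ be the minimizer of $\mathcal F_{\rm th}$ in $\mathcal K_{\rm th}$. For $u\in H^2(B_1^+)\cap\mathcal K_{\rm th}$ put $\nabla\mathcal F_{\rm th}(u)=-\Delta u\in L^2(B_1^+)$ and $$\|\nabla\mathcal F_{\rm th}(u)\|_{\mathcal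 K}=\sup\Big\{0,\ \sup_{v\in\mathcal K_{\rm th}\setminus\{u\}}\frac{-\langle v-u,\nabla\mathcal F_{\rm th}(u)\rangle_{L^2(B_1^+)}}{\|v-u\|_{L^2(B_1^+)}}\Big\}.$$ Then there is a constant $C_d>0$, depending only on $d$, such that $$\big(\mathcal F_{\rm th}(u)-\mathcal F_{\rm th}(\varphi)\big)^{1/2}\le C_d\,\|\nabla\mathcal F_{\rm th}(u)\|_{\mathcal K}$$ for every $u\in H^2(B_1^+)\cap\mathcal K_{\rm th}$ such that, in the sense of traces, $$\frac{\partial u}{\partial x_d}\le 0\quad\text{and}\quad u\,\frac{\partial u}{\partial x_d}=0\quad\text{on } B_1'.$$ -/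

import Mathlib

open MeasureTheory Filter Topology
open scoped ContDiff

noncomputable section

namespace ThinObstacle

/-- The Euclidean space `ℝ^m`. -/
abbrev Euc (m : ℕ) : Type := EuclideanSpace ℝ (Fin m)

/-- The Hilbert space `L²(Ω)` (Lebesgue measure) for a set `Ω ⊆ ℝ^m`. -/
abbrev L2 {m : ℕ} (Ω : Set (Euc m)) : Type := Lp ℝ 2 (volume.restrict Ω)

section Sobolev

variable {m : ℕ} {Ω : Set (Euc m)}

/-- The classical partial derivative `∂f/∂x_i`. -/
def pderiv (i : Fin m) (f : Euc m → ℝ) (x : Euc m) : ℝ :=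
  fderiv ℝ f x (EuclideanSpace.single i 1)

/-- `ψ ∈ C_c^∞(Ω)`. -/
def IsTest (Ω : Set (Euc m)) (ψ : Euc m → ℝ) : Prop :=
  ContDiff ℝ ∞ ψ ∧ HasCompactSupport ψ ∧ tsupport ψ ⊆ Ω

/-- `w ∈ L²(Ω)` is the weak partial derivative `∂u/∂x_i` of `u ∈ L²(Ω)` in the open set `Ω`. -/
def IsWeakPartial (i : Fin m) (u w : L2 Ω) : Prop :=
  ∀ ψ : Euc m → ℝ, IsTest Ω ψ →
    ∫ x in Ω, u x * pderiv i ψ x = - ∫ x in Ω, w x * ψ x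

/-- `u ∈ H¹(Ω)`: all the weak first derivatives exist in `L²(Ω)`. -/
def MemH1 (u : L2 Ω) : Prop :=
  ∀ i : Fin m, ∃ w : L2 Ω, IsWeakPartial i u w

open Classical in
/-- The weak derivative `∂u/∂x_i ∈ L²(Ω)` (set to `0` if there is none; it is unique). -/
def weakPartial (i : Fin m) (u : L2 Ω) : L2 Ω :=
  if h : ∃ w : L2 Ω, IsWeakPartial i u w then h.choose else 0

/-- `u ∈ H²(Ω)`: `u ∈ H¹(Ω)` and every weak first derivative is in `H¹(Ω)`. -/
def MemH2 (u : L2 Ω) : Prop :=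
  MemH1 u ∧ ∀ i : Fin m, MemH1 (weakPartial i u)

/-- The (weak) Laplacian `Δu ∈ L²(Ω)` of `u ∈ H²(Ω)`. -/
def laplacian (u : L2 Ω) : L2 Ω :=
  ∑ i : Fin m, weakPartial i (weakPartial i u)

/-- The smooth functions `f k`, restricted to `Ω`, converge to `u` in the norm of `H¹(Ω)`. -/
def TendstoH1 (f : ℕ → Euc m → ℝ) (u : L2 Ω) : Prop :=
  Tendsto (fun k => eLpNorm (fun x => f k x - u x) 2 (volume.restrict Ω)) atTop (𝓝 0) ∧
  ∀ i : Fin m, Tendsto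
    (fun k => eLpNorm (fun x => pderiv i (f k) x - weakPartial i u x) 2 (volume.restrict Ω))
    atTop (𝓝 0)

/-- `u ∈ H¹₀(Ω)`, the closure of `C_c^∞(Ω)` in `H¹(Ω)`. -/
def MemH10 (u : L2 Ω) : Prop :=
  MemH1 u ∧ ∃ f : ℕ → Euc m → ℝ, (∀ k, IsTest Ω (f k)) ∧ TendstoH1 f u

/-- The Dirichlet energy `½ ∫_Ω |∇u|² dx`. -/
def dirichlet (u : L2 Ω) : ℝ :=
  (1 / 2) * ∫ x in Ω, ∑ i : Fin m, (weakPartial i u x) ^ 2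

end Sobolev

/-- For a point `u` of a convex set `K` in a Hilbert space and for `G` (the gradient at `u` of a
functional), the constrained norm
`‖G‖_K = sup {0, sup_{v ∈ K \ {u}} - (v - u) · G / ‖v - u‖}`. -/
def constrainedNorm {H : Type*} [NormedAddCommGroup H] [InnerProductSpace ℝ H]
    (K : Set H) (u G : H) : ℝ :=
  sSup (insert 0 {r : ℝ | ∃ v ∈ K \ {u}, r = - inner ℝ (v - u) G / ‖v - u‖})

section Ball

variable {n : ℕ}

/-- The unit ball `B_1` of `ℝ^m`. -/
abbrev unitBall (m : ℕ) : Set (Euc m) := Metric.ball 0 1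

/-- The half ball `B_1^+ = B_1 ∩ {x_d > 0}` of `ℝ^d`, `d = n + 1`. -/
def halfBall (n : ℕ) : Set (Euc (n + 1)) := unitBall (n + 1) ∩ {x | 0 < x (Fin.last n)}

/-- The inclusion `x' ↦ (x', 0)` of `ℝ^(d-1)` in `ℝ^d`; it identifies the unit ball of
`ℝ^(d-1)` with `B_1' = B_1 ∩ {x_d = 0}`. -/
def flatIncl (y : Euc n) : Euc (n + 1) :=
  WithLp.toLp 2 (Fin.snoc (α := fun _ => ℝ) (fun j => y j) 0)

/-- The map `(x', x_d) ↦ (x', |x_d|)`. -/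
def fold (x : Euc (n + 1)) : Euc (n + 1) :=
  WithLp.toLp 2 (Function.update (fun j => x j) (Fin.last n) |x (Fin.last n)|)

/-- The reflection `(x', x_d) ↦ (x', -x_d)`. -/
def flip (n : ℕ) : Euc (n + 1) ≃ₗᵢ[ℝ] Euc (n + 1) :=
  LinearIsometryEquiv.piLpCongrRight 2
    (fun i => if i = Fin.last n then LinearIsometryEquiv.neg ℝ else LinearIsometryEquiv.refl ℝ ℝ)

theorem measurableSet_halfBall : MeasurableSet (halfBall n) :=
  measurableSet_ball.inter (measurableSet_lt measurable_const (by fun_prop))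

theorem fold_of_pos {x : Euc (n + 1)} (h : 0 ≤ x (Fin.last n)) : fold x = x := by
  ext j
  by_cases hj : j = Fin.last n
  · subst hj; simp [fold, abs_of_nonneg h]
  · simp [fold, hj]

theorem fold_of_neg {x : Euc (n + 1)} (h : x (Fin.last n) ≤ 0) : fold x = flip n x := by
  ext j
  by_cases hj : j = Fin.last n
  · subst hj; simp [fold, flip, abs_of_nonpos h]
  · simp [fold, flip, hj]

theorem flip_last (x : Euc (n + 1)) : flip n x (Fin.last n) = - x (Fin.last n) := by
  simp [flip]

theorem ae_last_ne_zero : ∀ᵐ x : Euc (n + 1), x (Fin.last n) ≠ 0 := by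
  have h := (EuclideanSpace.volume_preserving_symm_measurableEquiv_toLp
    (Fin (n + 1))).quasiMeasurePreserving.ae
    (p := fun y : Fin (n + 1) → ℝ => y (Fin.last n) ≠ 0) ?_
  · exact h
  · have := (Measure.quasiMeasurePreserving_eval (fun _ : Fin (n + 1) => (volume : Measure ℝ))
      (Fin.last n)).ae (p := fun t : ℝ => t ≠ 0) ?_
    · exact this
    · exact Measure.ae_ne volume 0

theorem memLp_comp_fold (u : L2 (halfBall n)) :
    MemLp (fun x => u (fold x)) 2 (volume.restrict (unitBall (n + 1))) := by
  have h1 : MemLp ((halfBall n).indicator u) 2 volume :=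
    (memLp_indicator_iff_restrict measurableSet_halfBall).2 (Lp.memLp u)
  have h2 := h1.comp_measurePreserving (flip n).measurePreserving
  refine ((h1.add h2).restrict (unitBall (n + 1))).ae_eq ?_
  filter_upwards [ae_restrict_mem measurableSet_ball, ae_restrict_of_ae ae_last_ne_zero]
    with x hx hx0
  have hx' : ‖x‖ < 1 := by simpa using hx
  rcases lt_or_gt_of_ne hx0 with h | h
  · have a1 : x ∉ halfBall n := fun hm => absurd hm.2 (not_lt.2 h.le)
    have a2 : flip n x ∈ halfBall n := by
      refine ⟨by simpa using hx', ?_⟩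
      simpa [flip_last] using h
    simp [a1, a2, fold_of_neg h.le]
  · have a1 : x ∈ halfBall n := ⟨hx, h⟩
    have a2 : flip n x ∉ halfBall n := by
      intro hm
      have := hm.2
      simp only [Set.mem_ofPred_eq, flip_last] at this
      linarith
    simp [a1, a2, fold_of_pos h.le]

/-- The even extension `(x', x_d) ↦ u(x', |x_d|)` to `B_1` of a function `u` on `B_1^+`. -/
def evenExt (u : L2 (halfBall n)) : L2 (unitBall (n + 1)) :=
  (memLp_comp_fold u).toLp

/-- `t ∈ L²(B_1')` is the trace on `B_1'` of `u ∈ H¹(B_1^+)`: there are smooth functions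
converging to `u` in `H¹(B_1^+)` whose restrictions to `B_1'` converge to `t` in `L²(B_1')`. -/
def HasFlatTrace (u : L2 (halfBall n)) (t : L2 (unitBall n)) : Prop :=
  MemH1 u ∧ ∃ f : ℕ → Euc (n + 1) → ℝ, (∀ k, ContDiff ℝ ∞ (f k)) ∧ TendstoH1 f u ∧
    Tendsto (fun k => eLpNorm (fun y => f k (flatIncl y) - t y) 2
      (volume.restrict (unitBall n))) atTop (𝓝 0)

/-- `u ≥ 0` on `B_1'` (in the sense of traces). -/
def FlatNonneg (u : L2 (halfBall n)) : Prop :=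
  ∃ t : L2 (unitBall n), HasFlatTrace u t ∧ ∀ᵐ y ∂volume.restrict (unitBall n), 0 ≤ t y

/-- The admissible set `K_th`: functions `u ∈ H¹(B_1^+)` with `u ≥ 0` on `B_1'` and `u = g` on
`∂B_1 ∩ {x_d > 0}`; the latter means that the even extension of `u - g` is in `H¹₀(B_1)`. -/
def admissible (g : L2 (halfBall n)) : Set (L2 (halfBall n)) :=
  {u | MemH1 u ∧ FlatNonneg u ∧ MemH10 (evenExt (u - g))}

/-- The thin-obstacle energy `½ ∫_{B_1} |∇u|² dx`, where `u` is extended evenly to `B_1`. -/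
def energy (u : L2 (halfBall n)) : ℝ := dirichlet (evenExt u)

/-- The gradient `-Δu ∈ L²(B_1^+)` of the thin-obstacle energy. -/
def gradEnergy (u : L2 (halfBall n)) : L2 (halfBall n) := - laplacian u

/-- `φ` minimizes the thin-obstacle energy in the admissible set with boundary datum `g`. -/
def IsMinimizer (g φ : L2 (halfBall n)) : Prop :=
  φ ∈ admissible g ∧ ∀ v ∈ admissible g, energy φ ≤ energy v

/-- The Signorini conditions `∂u/∂x_d ≤ 0` and `u ∂u/∂x_d = 0` on `B_1'`, for
`u ∈ H²(B_1^+)` and in the sense of traces. -/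
def Signorini (u : L2 (halfBall n)) : Prop :=
  ∃ t s : L2 (unitBall n), HasFlatTrace u t ∧ HasFlatTrace (weakPartial (Fin.last n) u) s ∧
    (∀ᵐ y ∂volume.restrict (unitBall n), s y ≤ 0) ∧
    (∀ᵐ y ∂volume.restrict (unitBall n), t y * s y = 0)

end Ball

end ThinObstacle

end

/-! Put `w = v - u` for an admissible `v`, and let `N` be the constrained norm. By even reflection
the energy is the full Dirichlet integral over the half ball, without the factor 1/2, so the energy
of `u` minus that of `v` is exactly `-2∫∇u·∇w - ∫|∇w|²`. Green's formula gives `∫∇u·∇w = -∫Δu w -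
∫_{B₁'} (∂u/∂x_d) w`. The Signorini conditions and `v ≥ 0` on the flat part make the last term, with
its sign, nonnegative, hence `-∫∇u·∇w ≤ N‖w‖`. The Poincaré inequality `‖w‖ ≤ 2‖∂w/∂x_d‖` bounds the
gap by `4Na - a² ≤ 4N²` with `a = ‖∂w/∂x_d‖`; this is `energy_sub_le`, applied at the end with `v =
φ`.

The work lies in justifying Green's formula for weak traces. The boundary condition makes `w` an
`H¹` limit of test functions of the whole ball (`exists_isTest_tendstoH1_sub`), for which the
formula holds with a boundary term on `B₁'` only (`MemH2.sum_inner_pderiv`). The trace inequality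
then lets the boundary term pass to the limit (`HasFlatTrace.tendsto_flat`). -/

noncomputable section

namespace ThinObstacle

/-! ### Fubini and the fundamental theorem of calculus in a half-space. -/

section HalfSpace

variable {n : ℕ}

/-- The splitting `ℝ^(n+1) ≃ ℝ^n × ℝ`, `x ↦ (x', x_d)`. -/
def splitLast (n : ℕ) : Euc (n + 1) ≃ᵐ Euc n × ℝ :=
  (MeasurableEquiv.toLp 2 (Fin (n + 1) → ℝ)).symm.trans
    ((MeasurableEquiv.piFinSuccAbove (fun _ => ℝ) (Fin.last n)).trans
      (((MeasurableEquiv.refl ℝ).prodCongr (MeasurableEquiv.toLp 2 (Fin n → ℝ))).trans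
        MeasurableEquiv.prodComm))

theorem measurePreserving_splitLast : MeasurePreserving (splitLast n) := by
  have h1 := EuclideanSpace.volume_preserving_symm_measurableEquiv_toLp (Fin (n + 1))
  have h2 := volume_preserving_piFinSuccAbove (fun _ : Fin (n + 1) => ℝ) (Fin.last n)
  have h3 : MeasurePreserving (Prod.map (id : ℝ → ℝ) (MeasurableEquiv.toLp 2 (Fin n → ℝ)))
      (volume.prod volume) (volume.prod volume) :=
    (MeasurePreserving.id volume).prod
      (EuclideanSpace.volume_preserving_symm_measurableEquiv_toLp (Fin n)).symm
  exact (Measure.measurePreserving_swap.comp h3).comp (h2.comp h1)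

@[simp] theorem flatIncl_last (y : Euc n) : flatIncl y (Fin.last n) = 0 := by
  simp [flatIncl]

@[simp] theorem flatIncl_castSucc (y : Euc n) (j : Fin n) : flatIncl y j.castSucc = y j := by
  simp [flatIncl]

theorem splitLast_symm (y : Euc n) (t : ℝ) :
    (splitLast n).symm (y, t) = flatIncl y + t • EuclideanSpace.single (Fin.last n) (1 : ℝ) := by
  rw [MeasurableEquiv.symm_apply_eq]
  refine Prod.ext ?_ ?_
  · ext j
    change _ = (flatIncl y + t • EuclideanSpace.single (Fin.last n) (1 : ℝ))
      ((Fin.last n).succAbove j)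
    simp
  · change _ = (flatIncl y + t • EuclideanSpace.single (Fin.last n) (1 : ℝ)) (Fin.last n)
    simp

theorem norm_flatIncl (y : Euc n) : ‖flatIncl y‖ = ‖y‖ := by
  simp [EuclideanSpace.norm_eq, Fin.sum_univ_castSucc]

theorem contDiff_flatIncl : ContDiff ℝ ∞ (flatIncl (n := n)) := by
  rw [contDiff_euclidean]
  intro i
  refine Fin.lastCases ?_ (fun j => ?_) i
  · simpa using contDiff_const
  · simp only [flatIncl_castSucc]
    fun_prop

theorem integral_halfSpace {h : Euc (n + 1) → ℝ} (hh : Integrable h) :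
    ∫ x in {x : Euc (n + 1) | 0 < x (Fin.last n)}, h x =
      ∫ y : Euc n, ∫ t in Set.Ioi (0 : ℝ),
        h (flatIncl y + t • EuclideanSpace.single (Fin.last n) (1 : ℝ)) := by
  have mp := (measurePreserving_splitLast (n := n)).symm
  have hset : (splitLast n).symm ⁻¹' {x : Euc (n + 1) | 0 < x (Fin.last n)} =
      Set.univ ×ˢ Set.Ioi (0 : ℝ) := by
    ext ⟨y, t⟩
    simp [splitLast_symm]
  rw [← mp.setIntegral_preimage_emb (splitLast n).symm.measurableEmbedding, hset]
  have hi : Integrable (fun z => h ((splitLast n).symm z)) (volume.prod volume) :=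
    mp.integrable_comp_of_integrable hh
  have := setIntegral_prod (μ := (volume : Measure (Euc n))) (ν := (volume : Measure ℝ))
    (fun z => h ((splitLast n).symm z)) (s := Set.univ) (t := Set.Ioi (0 : ℝ)) hi.integrableOn
  simp only [splitLast_symm, setIntegral_univ] at this
  exact this

theorem continuous_pderiv {m : ℕ} (i : Fin m) {f : Euc m → ℝ} (hf : ContDiff ℝ 1 f) :
    Continuous (pderiv i f) :=
  (hf.continuous_fderiv one_ne_zero).clm_apply continuous_const

theorem hasCompactSupport_pderiv {m : ℕ} (i : Fin m) {f : Euc m → ℝ} (hf : HasCompactSupport f) :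
    HasCompactSupport (pderiv i f) :=
  hf.fderiv_apply ℝ _

theorem tsupport_pderiv_subset {m : ℕ} (i : Fin m) (f : Euc m → ℝ) :
    tsupport (pderiv i f) ⊆ tsupport f :=
  tsupport_fderiv_apply_subset ℝ _

theorem pderiv_mul {m : ℕ} (i : Fin m) {f g : Euc m → ℝ} (hf : ContDiff ℝ 1 f)
    (hg : ContDiff ℝ 1 g) (x : Euc m) :
    pderiv i (fun x => f x * g x) x = f x * pderiv i g x + pderiv i f x * g x := by
  have h := ((hf.differentiable one_ne_zero x).hasFDerivAt.mul
    (hg.differentiable one_ne_zero x).hasFDerivAt).fderiv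
  simp only [pderiv]
  rw [show (fun x => f x * g x) = f * g from rfl, h]
  simp [mul_comm]

/-- The fundamental theorem of calculus in a half-space. -/
theorem integral_halfSpace_pderiv_last {h : Euc (n + 1) → ℝ} (hh : ContDiff ℝ 1 h)
    (hc : HasCompactSupport h) :
    ∫ x in {x : Euc (n + 1) | 0 < x (Fin.last n)}, pderiv (Fin.last n) h x =
      - ∫ y : Euc n, h (flatIncl y) := by
  rw [integral_halfSpace ((continuous_pderiv _ hh).integrable_of_hasCompactSupport
    (hasCompactSupport_pderiv _ hc)), ← integral_neg]
  refine integral_congr_ae (Eventually.of_forall fun y => ?_)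
  set e : Euc (n + 1) := EuclideanSpace.single (Fin.last n) (1 : ℝ) with he
  have hl : ∀ t : ℝ, HasDerivAt (fun t : ℝ => flatIncl y + t • e) e t := fun t => by
    simpa using ((hasDerivAt_id t).smul_const e).const_add (flatIncl y)
  -- A vertical line is closedly embedded, so `h` keeps compact support along it and only the
  -- endpoint `t = 0` contributes.
  have hemb : IsClosedEmbedding (fun t : ℝ => flatIncl y + t • e) := by
    refine (Homeomorph.addLeft (flatIncl y)).isClosedEmbedding.comp ?_
    refine isClosedEmbedding_smul_left ?_
    simp [he]
  have hc1 : HasCompactSupport (fun t : ℝ => h (flatIncl y + t • e)) :=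
    hc.comp_isClosedEmbedding hemb
  have hs : ContDiff ℝ 1 (fun t : ℝ => h (flatIncl y + t • e)) := hh.comp (by fun_prop)
  have := hc1.integral_Ioi_deriv_eq hs 0
  simp only [zero_smul, add_zero] at this
  refine Eq.trans ?_ this
  refine integral_congr_ae (Eventually.of_forall fun t => ?_)
  exact ((hh.differentiable one_ne_zero _).hasFDerivAt.comp_hasDerivAt t (hl t)).deriv.symm

end HalfSpace

/-! ### Classes in `L²` and the fundamental lemma of the calculus of variations. -/

section Lebesgue

variable {m : ℕ} {Ω : Set (Euc m)}

open Classical in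
/-- The class in `L²(Ω)` of a square integrable function (`0` for other functions). -/
def toL2 (Ω : Set (Euc m)) (f : Euc m → ℝ) : L2 Ω :=
  if h : MemLp f 2 (volume.restrict Ω) then h.toLp else 0

theorem coeFn_toL2 {f : Euc m → ℝ} (h : MemLp f 2 (volume.restrict Ω)) :
    toL2 Ω f =ᵐ[volume.restrict Ω] f := by
  rw [toL2, dif_pos h]
  exact h.coeFn_toLp

theorem inner_L2 (u v : L2 Ω) : inner ℝ u v = ∫ x in Ω, u x * v x := by
  rw [L2.inner_def]
  exact integral_congr_ae (Eventually.of_forall fun x => by simp [mul_comm])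

theorem inner_toL2 (u : L2 Ω) {f : Euc m → ℝ} (h : MemLp f 2 (volume.restrict Ω)) :
    inner ℝ u (toL2 Ω f) = ∫ x in Ω, u x * f x := by
  rw [inner_L2]
  refine integral_congr_ae ?_
  filter_upwards [coeFn_toL2 h] with x hx
  rw [hx]

theorem inner_toL2_toL2 {f g : Euc m → ℝ} (hf : MemLp f 2 (volume.restrict Ω))
    (hg : MemLp g 2 (volume.restrict Ω)) :
    inner ℝ (toL2 Ω f) (toL2 Ω g) = ∫ x in Ω, f x * g x := by
  rw [inner_toL2 _ hg]
  refine integral_congr_ae ?_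
  filter_upwards [coeFn_toL2 hf] with x hx
  rw [hx]

theorem tendsto_toL2 {f : ℕ → Euc m → ℝ} {u : L2 Ω}
    (hf : ∀ k, MemLp (f k) 2 (volume.restrict Ω))
    (h : Tendsto (fun k => eLpNorm (fun x => f k x - u x) 2 (volume.restrict Ω)) atTop (𝓝 0)) :
    Tendsto (fun k => toL2 Ω (f k)) atTop (𝓝 u) := by
  rw [Lp.tendsto_Lp_iff_tendsto_eLpNorm']
  refine h.congr fun k => eLpNorm_congr_ae ?_
  filter_upwards [coeFn_toL2 (hf k)] with x hx
  simp [hx]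

theorem toL2_sub {f g : Euc m → ℝ} (hf : MemLp f 2 (volume.restrict Ω))
    (hg : MemLp g 2 (volume.restrict Ω)) :
    toL2 Ω (fun x => f x - g x) = toL2 Ω f - toL2 Ω g := by
  refine Lp.ext ?_
  filter_upwards [coeFn_toL2 (hf.sub hg), coeFn_toL2 hf, coeFn_toL2 hg,
    Lp.coeFn_sub (toL2 Ω f) (toL2 Ω g)] with x h1 h2 h3 h4
  rw [h4, Pi.sub_apply, h2, h3]
  exact h1

/-- Compactness of the closed ball bounds `f`. This places in `L²` the smooth approximants of a
trace, which need not have compact support. -/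
theorem memLp_of_continuous (hΩ : Ω ⊆ unitBall m) {f : Euc m → ℝ} (hf : Continuous f) :
    MemLp f 2 (volume.restrict Ω) := by
  obtain ⟨C, hC⟩ := (isCompact_closedBall (0 : Euc m) 1).exists_bound_of_continuousOn
    hf.continuousOn
  have : MemLp f 2 (volume.restrict (unitBall m)) := by
    have : IsFiniteMeasure (volume.restrict (unitBall m)) :=
      isFiniteMeasure_restrict.2 measure_ball_lt_top.ne
    refine MemLp.of_bound hf.aestronglyMeasurable C ?_
    filter_upwards [ae_restrict_mem measurableSet_ball] with x hx
    exact hC x (Metric.ball_subset_closedBall hx)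
  exact this.mono_measure (Measure.restrict_mono hΩ le_rfl)

theorem ae_eq_zero_of_forall_isTest (hΩ : IsOpen Ω) (u : L2 Ω)
    (h : ∀ ψ, IsTest Ω ψ → ∫ x in Ω, u x * ψ x = 0) : u = 0 := by
  have hloc : LocallyIntegrableOn u Ω volume := by
    refine (locallyIntegrableOn_iff hΩ.isLocallyClosed).2 fun K hK hKc => ?_
    have := ((Lp.memLp u).locallyIntegrable (by norm_num)).integrableOn_isCompact hKc
    rwa [IntegrableOn, Measure.restrict_restrict hKc.measurableSet,
      Set.inter_eq_left.2 hK] at this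
  have := hΩ.ae_eq_zero_of_integral_contDiff_smul_eq_zero hloc fun ψ h1 h2 h3 => by
    rw [← h ψ ⟨h1, h2, h3⟩, ← setIntegral_eq_integral_of_forall_compl_eq_zero (s := Ω)]
    · exact integral_congr_ae (Eventually.of_forall fun x => by simp [mul_comm])
    · intro x hx
      rw [image_eq_zero_of_notMem_tsupport fun hm => hx (h3 hm), zero_smul]
  refine Lp.ext ?_
  filter_upwards [ae_restrict_of_ae this, ae_restrict_mem hΩ.measurableSet, Lp.coeFn_zero ℝ 2
    (volume.restrict Ω)] with x h1 h2 h3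
  rw [h1 h2, h3]
  rfl

end Lebesgue

/-! ### Calculus of weak derivatives. -/

section Sobolev

variable {m : ℕ} {Ω : Set (Euc m)}

theorem IsTest.contDiff_one {ψ : Euc m → ℝ} (h : IsTest Ω ψ) : ContDiff ℝ 1 ψ :=
  h.1.of_le (by norm_num)

theorem IsTest.eq_zero {ψ : Euc m → ℝ} (h : IsTest Ω ψ) {x : Euc m} (hx : x ∉ Ω) : ψ x = 0 :=
  image_eq_zero_of_notMem_tsupport fun hm => hx (h.2.2 hm)

theorem IsTest.pderiv_eq_zero {ψ : Euc m → ℝ} (h : IsTest Ω ψ) (i : Fin m) {x : Euc m}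
    (hx : x ∉ Ω) : pderiv i ψ x = 0 :=
  image_eq_zero_of_notMem_tsupport fun hm => hx (h.2.2 (tsupport_pderiv_subset i ψ hm))

theorem IsTest.memLp {ψ : Euc m → ℝ} (h : IsTest Ω ψ) {Ω' : Set (Euc m)} :
    MemLp ψ 2 (volume.restrict Ω') :=
  h.1.continuous.memLp_of_hasCompactSupport h.2.1

theorem IsTest.memLp_pderiv {ψ : Euc m → ℝ} (h : IsTest Ω ψ) (i : Fin m) {Ω' : Set (Euc m)} :
    MemLp (pderiv i ψ) 2 (volume.restrict Ω') :=
  (continuous_pderiv i h.contDiff_one).memLp_of_hasCompactSupport (hasCompactSupport_pderiv i h.2.1)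

theorem IsTest.sub {ψ χ : Euc m → ℝ} (hψ : IsTest Ω ψ) (hχ : IsTest Ω χ) :
    IsTest Ω (fun x => ψ x - χ x) :=
  ⟨hψ.1.sub hχ.1, hψ.2.1.sub hχ.2.1,
    (tsupport_sub ψ χ).trans (Set.union_subset hψ.2.2 hχ.2.2)⟩

theorem pderiv_sub (i : Fin m) {f g : Euc m → ℝ} (hf : ContDiff ℝ 1 f) (hg : ContDiff ℝ 1 g) :
    pderiv i (fun x => f x - g x) = fun x => pderiv i f x - pderiv i g x := by
  funext x
  simp only [pderiv]
  rw [fderiv_fun_sub (hf.differentiable one_ne_zero x) (hg.differentiable one_ne_zero x)]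
  rfl

/-- In this form linearity of weak derivatives is linearity of the inner product. -/
theorem isWeakPartial_iff_inner {i : Fin m} {u w : L2 Ω} :
    IsWeakPartial i u w ↔ ∀ ψ, IsTest Ω ψ →
      inner ℝ u (toL2 Ω (pderiv i ψ)) = - inner ℝ w (toL2 Ω ψ) := by
  refine forall₂_congr fun ψ hψ => ?_
  rw [inner_toL2 _ (hψ.memLp_pderiv i), inner_toL2 _ hψ.memLp]

theorem isWeakPartial_weakPartial {u : L2 Ω} (hu : MemH1 u) (i : Fin m) :
    IsWeakPartial i u (weakPartial i u) := by
  rw [weakPartial, dif_pos (hu i)]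
  exact (hu i).choose_spec

theorem IsWeakPartial.unique (hΩ : IsOpen Ω) {i : Fin m} {u w w' : L2 Ω}
    (h : IsWeakPartial i u w) (h' : IsWeakPartial i u w') : w = w' := by
  rw [← sub_eq_zero]
  refine ae_eq_zero_of_forall_isTest hΩ _ fun ψ hψ => ?_
  rw [isWeakPartial_iff_inner] at h h'
  rw [← inner_toL2 _ hψ.memLp, inner_sub_left]
  linarith [h ψ hψ, h' ψ hψ]

/-- Uniqueness makes the choice in the definition of `weakPartial` immaterial. -/
theorem IsWeakPartial.weakPartial_eq (hΩ : IsOpen Ω) {i : Fin m} {u w : L2 Ω}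
    (h : IsWeakPartial i u w) : weakPartial i u = w := by
  have hex : ∃ w : L2 Ω, IsWeakPartial i u w := ⟨w, h⟩
  rw [weakPartial, dif_pos hex]
  exact hex.choose_spec.unique hΩ h

theorem IsWeakPartial.sub {i : Fin m} {u v w z : L2 Ω}
    (h : IsWeakPartial i u w) (h' : IsWeakPartial i v z) : IsWeakPartial i (u - v) (w - z) := by
  rw [isWeakPartial_iff_inner] at h h' ⊢
  intro ψ hψ
  rw [inner_sub_left, inner_sub_left, h ψ hψ, h' ψ hψ]
  ring

theorem MemH1.sub {u v : L2 Ω} (hu : MemH1 u) (hv : MemH1 v) : MemH1 (u - v) := fun i =>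
  ⟨_, (isWeakPartial_weakPartial hu i).sub (isWeakPartial_weakPartial hv i)⟩

theorem weakPartial_sub (hΩ : IsOpen Ω) {u v : L2 Ω} (hu : MemH1 u) (hv : MemH1 v) (i : Fin m) :
    weakPartial i (u - v) = weakPartial i u - weakPartial i v :=
  ((isWeakPartial_weakPartial hu i).sub (isWeakPartial_weakPartial hv i)).weakPartial_eq hΩ

theorem TendstoH1.tendsto_toL2 (hΩ : Ω ⊆ unitBall m) {f : ℕ → Euc m → ℝ} {u : L2 Ω}
    (hf : ∀ k, ContDiff ℝ ∞ (f k)) (h : TendstoH1 f u) :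
    Tendsto (fun k => toL2 Ω (f k)) atTop (𝓝 u) :=
  ThinObstacle.tendsto_toL2 (fun k => memLp_of_continuous hΩ (hf k).continuous) h.1

theorem TendstoH1.tendsto_toL2_pderiv (hΩ : Ω ⊆ unitBall m) {f : ℕ → Euc m → ℝ} {u : L2 Ω}
    (hf : ∀ k, ContDiff ℝ ∞ (f k)) (h : TendstoH1 f u) (i : Fin m) :
    Tendsto (fun k => toL2 Ω (pderiv i (f k))) atTop (𝓝 (weakPartial i u)) :=
  ThinObstacle.tendsto_toL2 (fun k => memLp_of_continuous hΩ
    (continuous_pderiv i ((hf k).of_le (by norm_num)))) (h.2 i)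

end Sobolev

/-! ### Integration by parts on the half ball against test functions of the whole ball. -/

section Green

variable {n : ℕ}

theorem isOpen_halfBall : IsOpen (halfBall n) :=
  Metric.isOpen_ball.inter (isOpen_lt continuous_const (by fun_prop))

theorem halfBall_subset : halfBall n ⊆ unitBall (n + 1) := Set.inter_subset_left

theorem IsTest.flatIncl_eq_zero {ψ : Euc (n + 1) → ℝ} (h : IsTest (unitBall (n + 1)) ψ) {y : Euc n}
    (hy : y ∉ unitBall n) : ψ (flatIncl y) = 0 :=
  h.eq_zero fun hm => hy (by simpa [norm_flatIncl] using hm)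

/-- Integration by parts in the direction `x_d` for smooth functions on the half ball. -/
theorem inner_pderiv_last_add {f ψ : Euc (n + 1) → ℝ} (hf : ContDiff ℝ ∞ f)
    (hψ : IsTest (unitBall (n + 1)) ψ) :
    inner ℝ (toL2 (halfBall n) f) (toL2 (halfBall n) (pderiv (Fin.last n) ψ)) +
      inner ℝ (toL2 (halfBall n) (pderiv (Fin.last n) f)) (toL2 (halfBall n) ψ) =
    - inner ℝ (toL2 (unitBall n) (fun y => f (flatIncl y)))
        (toL2 (unitBall n) (fun y => ψ (flatIncl y))) := by
  have hf1 : ContDiff ℝ 1 f := hf.of_le (by norm_num)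
  have m1 := memLp_of_continuous (halfBall_subset (n := n)) hf.continuous
  have m2 := memLp_of_continuous (halfBall_subset (n := n)) (continuous_pderiv (Fin.last n) hf1)
  have m3 : MemLp (fun y => f (flatIncl y)) 2 (volume.restrict (unitBall n)) :=
    memLp_of_continuous le_rfl (hf.continuous.comp contDiff_flatIncl.continuous)
  have m4 : MemLp (fun y => ψ (flatIncl y)) 2 (volume.restrict (unitBall n)) :=
    memLp_of_continuous le_rfl     (hψ.1.continuous.comp contDiff_flatIncl.continuous)
  have m5 : MemLp (pderiv (Fin.last n) ψ) 2 (volume.restrict (halfBall n)) := hψ.memLp_pderiv _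
  have m6 : MemLp ψ 2 (volume.restrict (halfBall n)) := hψ.memLp
  rw [inner_toL2_toL2 m1 m5, inner_toL2_toL2 m2 m6, inner_toL2_toL2 m3 m4]
  refine (integral_add (m1.integrable_mul m5) (m2.integrable_mul m6)).symm.trans ?_
  -- The product `f ψ` inherits compact support from `ψ`; half-space and half ball give the same
  -- integral because `ψ` and its derivative vanish off the ball.
  have key := integral_halfSpace_pderiv_last (hf1.mul hψ.contDiff_one) hψ.2.1.mul_left
  have hb : ∫ y in unitBall n, f (flatIncl y) * ψ (flatIncl y) =
      ∫ y, f (flatIncl y) * ψ (flatIncl y) :=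
    setIntegral_eq_integral_of_forall_compl_eq_zero fun y hy => by
      simp [hψ.flatIncl_eq_zero hy]
  refine Eq.trans ?_ (key.trans (congrArg Neg.neg hb.symm))
  rw [← setIntegral_eq_of_subset_of_forall_sdiff_eq_zero (s := halfBall n)
    (isOpen_lt continuous_const (by fun_prop)).measurableSet Set.inter_subset_right]
  · refine integral_congr_ae (Eventually.of_forall fun x => ?_)
    exact (pderiv_mul _ hf1 hψ.contDiff_one x).symm
  · intro x hx
    have hx' : x ∉ unitBall (n + 1) := fun h => hx.2 ⟨h, hx.1⟩
    simp [hψ.eq_zero hx', hψ.pderiv_eq_zero _ hx']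

/-- Integration by parts in the direction `x_d` on the half ball. -/
theorem HasFlatTrace.inner_pderiv_last_add {u : L2 (halfBall n)} {t : L2 (unitBall n)}
    (h : HasFlatTrace u t) {ψ : Euc (n + 1) → ℝ} (hψ : IsTest (unitBall (n + 1)) ψ) :
    inner ℝ u (toL2 (halfBall n) (pderiv (Fin.last n) ψ)) +
      inner ℝ (weakPartial (Fin.last n) u) (toL2 (halfBall n) ψ) =
    - inner ℝ t (toL2 (unitBall n) (fun y => ψ (flatIncl y))) := by
  obtain ⟨-, f, hf, hfu, hft⟩ := h
  have h1 := hfu.tendsto_toL2 halfBall_subset hf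
  have h2 := hfu.tendsto_toL2_pderiv halfBall_subset hf (Fin.last n)
  have h3 := tendsto_toL2 (fun k => memLp_of_continuous (Ω := unitBall n) le_rfl
    ((hf k).continuous.comp contDiff_flatIncl.continuous)) hft
  have l1 := (h1.inner (tendsto_const_nhds (x := toL2 (halfBall n) (pderiv (Fin.last n) ψ)))
    (𝕜 := ℝ)).add (h2.inner (tendsto_const_nhds (x := toL2 (halfBall n) ψ)) (𝕜 := ℝ))
  have l2 := (h3.inner (tendsto_const_nhds
    (x := toL2 (unitBall n) (fun y => ψ (flatIncl y)))) (𝕜 := ℝ)).neg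
  refine tendsto_nhds_unique l1 (l2.congr fun k => ?_)
  exact (ThinObstacle.inner_pderiv_last_add (hf k) hψ).symm

/-- Integration by parts in a tangential direction on the half ball. -/
theorem IsWeakPartial.inner_pderiv_castSucc {i : Fin n} {u w : L2 (halfBall n)}
    (h : IsWeakPartial i.castSucc u w) {ψ : Euc (n + 1) → ℝ} (hψ : IsTest (unitBall (n + 1)) ψ) :
    inner ℝ u (toL2 (halfBall n) (pderiv i.castSucc ψ)) = - inner ℝ w (toL2 (halfBall n) ψ) := by
  -- The cutoff vanishes where `k x_d ≤ 1` and equals 1 where `k x_d ≥ 2`. It depends on `x_d`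
  -- alone, so tangential derivatives do not see it and no boundary term appears.
  set η : ℕ → Euc (n + 1) → ℝ := fun k x =>
    Real.smoothTransition ((k : ℝ) * x (Fin.last n) - 1) with hη
  have hηs : ∀ k, ContDiff ℝ ∞ (η k) := fun k =>
    Real.smoothTransition.contDiff.comp (by fun_prop)
  have hηs1 : ∀ k, ContDiff ℝ 1 (η k) := fun k => (hηs k).of_le (by norm_num)
  have hη1 : ∀ k x, |η k x| ≤ 1 := fun k x =>
    abs_le.2 ⟨by linarith [Real.smoothTransition.nonneg ((k : ℝ) * x (Fin.last n) - 1)],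
      Real.smoothTransition.le_one _⟩
  have hlim : ∀ x ∈ halfBall n, Tendsto (fun k => η k x) atTop (𝓝 1) := by
    intro x hx
    have hx0 : 0 < x (Fin.last n) := hx.2
    refine tendsto_const_nhds.congr' ?_
    have ht : Tendsto (fun k : ℕ => (k : ℝ) * x (Fin.last n)) atTop atTop :=
      tendsto_natCast_atTop_atTop.atTop_mul_const hx0
    filter_upwards [ht.eventually_ge_atTop 2] with k hk
    exact (Real.smoothTransition.one_of_one_le (by linarith)).symm
  have hη0 : ∀ k x, pderiv i.castSucc (η k) x = 0 := by
    intro k x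
    have hl : HasFDerivAt (fun x : Euc (n + 1) => (k : ℝ) * x (Fin.last n) - 1)
        ((k : ℝ) • (EuclideanSpace.proj (Fin.last n) : Euc (n + 1) →L[ℝ] ℝ)) x :=
      ((EuclideanSpace.proj (Fin.last n) : Euc (n + 1) →L[ℝ] ℝ).hasFDerivAt.const_mul
        (k : ℝ)).sub_const 1
    have hs : DifferentiableAt ℝ Real.smoothTransition ((k : ℝ) * x (Fin.last n) - 1) :=
      (Real.smoothTransition.contDiff (n := 1)).differentiable (by norm_num) _
    have := (hs.hasFDerivAt.comp x hl).fderiv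
    change fderiv ℝ (Real.smoothTransition ∘ fun x : Euc (n + 1) =>
      (k : ℝ) * x (Fin.last n) - 1) x _ = 0
    rw [this]
    simp
  have htest : ∀ k, IsTest (halfBall n) (fun x => η k x * ψ x) := by
    intro k
    refine ⟨(hηs k).mul hψ.1, hψ.2.1.mul_left, fun x hx => ⟨hψ.2.2 ?_, ?_⟩⟩
    · exact tsupport_mul_subset_right hx
    · have hx' : x ∈ tsupport (η k) := tsupport_mul_subset_left hx
      have hcl : IsClosed {x : Euc (n + 1) | 1 ≤ (k : ℝ) * x (Fin.last n)} :=
        isClosed_le continuous_const (by fun_prop)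
      have hsub : tsupport (η k) ⊆ {x : Euc (n + 1) | 1 ≤ (k : ℝ) * x (Fin.last n)} := by
        refine closure_minimal (fun z hz => ?_) hcl
        by_contra hlt
        refine hz (Real.smoothTransition.zero_of_nonpos ?_)
        have : (k : ℝ) * z (Fin.last n) < 1 := not_le.1 hlt
        linarith
      have h1 : 1 ≤ (k : ℝ) * x (Fin.last n) := hsub hx'
      by_contra hneg
      have : x (Fin.last n) ≤ 0 := not_lt.1 hneg
      nlinarith [(Nat.cast_nonneg k : (0 : ℝ) ≤ k)]
  -- Dominated convergence removes the cutoff, since `|η k| ≤ 1` and `η k → 1` on the half ball.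
  have conv : ∀ (v : L2 (halfBall n)) (χ : Euc (n + 1) → ℝ),
      MemLp χ 2 (volume.restrict (halfBall n)) →
      Tendsto (fun k => ∫ x in halfBall n, v x * (η k x * χ x)) atTop
        (𝓝 (∫ x in halfBall n, v x * χ x)) := by
    intro v χ hχ
    have hint := (Lp.memLp v).integrable_mul hχ
    refine tendsto_integral_of_dominated_convergence (fun x => ‖v x * χ x‖) (fun k => ?_)
      hint.norm (fun k => Eventually.of_forall fun x => ?_) ?_
    · exact (Lp.aestronglyMeasurable v).mul
        ((hηs k).continuous.aestronglyMeasurable.mul hχ.1)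
    · rw [show v x * (η k x * χ x) = η k x * (v x * χ x) by ring, norm_mul]
      exact mul_le_of_le_one_left (norm_nonneg _) (hη1 k x)
    · filter_upwards [ae_restrict_mem measurableSet_halfBall] with x hx
      simpa using ((hlim x hx).mul_const (χ x)).const_mul (v x)
  rw [inner_toL2 _ (hψ.memLp_pderiv _), inner_toL2 _ hψ.memLp]
  refine tendsto_nhds_unique (conv u _ (hψ.memLp_pderiv i.castSucc)) ?_
  refine (conv w ψ hψ.memLp).neg.congr fun k => ?_
  rw [← h _ (htest k)]
  refine integral_congr_ae (Eventually.of_forall fun x => ?_)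
  simp only [pderiv_mul _ (hηs1 k) hψ.contDiff_one, hη0, zero_mul, add_zero]

end Green

/-! ### Even reflection: weak derivatives and energy of the extension. -/

section Reflection

variable {n : ℕ}

/-- The sign of the coordinate `i` under the reflection in `x_d`. -/
def reflSign (i : Fin (n + 1)) : ℝ := if i = Fin.last n then -1 else 1

theorem reflSign_mul_self (i : Fin (n + 1)) : reflSign i * reflSign i = 1 := by
  unfold reflSign
  split_ifs <;> norm_num

theorem flip_flip (x : Euc (n + 1)) : flip n (flip n x) = x := by
  ext j
  by_cases hj : j = Fin.last n <;> simp [flip, hj]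

theorem flip_single (i : Fin (n + 1)) :
    flip n (EuclideanSpace.single i (1 : ℝ)) = reflSign i • EuclideanSpace.single i (1 : ℝ) := by
  ext j
  by_cases hj : j = Fin.last n <;> by_cases hij : j = i <;> by_cases hi : i = Fin.last n <;>
    simp_all [flip, reflSign]

theorem flip_flatIncl (y : Euc n) : flip n (flatIncl y) = flatIncl y := by
  rw [← fold_of_neg (by simp), fold_of_pos (by simp)]

theorem pderiv_comp_flip (i : Fin (n + 1)) {ψ : Euc (n + 1) → ℝ} (hψ : ContDiff ℝ 1 ψ)
    (x : Euc (n + 1)) :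
    pderiv i (fun x => ψ (flip n x)) x = reflSign i * pderiv i ψ (flip n x) := by
  have h := ((hψ.differentiable one_ne_zero (flip n x)).hasFDerivAt.comp x
    (flip n).toContinuousLinearEquiv.hasFDerivAt).fderiv
  have h' : pderiv i (fun x => ψ (flip n x)) x =
      fderiv ℝ ψ (flip n x) (flip n (EuclideanSpace.single i (1 : ℝ))) :=
    congrArg (fun L : Euc (n + 1) →L[ℝ] ℝ => L (EuclideanSpace.single i 1)) h
  rw [h', flip_single, map_smul]
  rfl

theorem IsTest.comp_flip {ψ : Euc (n + 1) → ℝ} (hψ : IsTest (unitBall (n + 1)) ψ) :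
    IsTest (unitBall (n + 1)) (fun x => ψ (flip n x)) := by
  refine ⟨hψ.1.comp (flip n).contDiff, hψ.2.1.comp_homeomorph (flip n).toHomeomorph, ?_⟩
  have := tsupport_comp_eq_preimage ψ (flip n).toHomeomorph
  intro x hx
  have hx' : flip n x ∈ tsupport ψ := by
    have : x ∈ (flip n).toHomeomorph ⁻¹' tsupport ψ := this ▸ hx
    exact this
  have := hψ.2.2 hx'
  simpa using this

theorem IsTest.add_smul_comp_flip {ψ : Euc (n + 1) → ℝ} (hψ : IsTest (unitBall (n + 1)) ψ)
    (c : ℝ) : IsTest (unitBall (n + 1)) (fun x => ψ x + c * ψ (flip n x)) := by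
  have h := hψ.comp_flip
  refine ⟨hψ.1.add (contDiff_const.mul h.1), hψ.2.1.add h.2.1.mul_left, ?_⟩
  refine (tsupport_add _ _).trans (Set.union_subset hψ.2.2 ?_)
  exact (tsupport_mul_subset_right (f := fun _ => c)).trans h.2.2

/-- The sign from the chain rule cancels the sign in the combination. The resulting derivative is
even, as needed when an integral against an even function is folded onto the half ball. -/
theorem pderiv_add_smul_comp_flip (i : Fin (n + 1)) {ψ : Euc (n + 1) → ℝ} (hψ : ContDiff ℝ 1 ψ)
    (x : Euc (n + 1)) :
    pderiv i (fun x => ψ x + reflSign i * ψ (flip n x)) x =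
      pderiv i ψ x + pderiv i ψ (flip n x) := by
  have hc : ContDiff ℝ 1 (fun x => ψ (flip n x)) := hψ.comp (flip n).contDiff
  have h1 : pderiv i (fun x => ψ x + reflSign i * ψ (flip n x)) x =
      pderiv i ψ x + reflSign i * pderiv i (fun x => ψ (flip n x)) x := by
    simp only [pderiv]
    rw [fderiv_fun_add (hψ.differentiable one_ne_zero x)
      ((hc.differentiable one_ne_zero x).const_mul _),
      fderiv_const_mul (hc.differentiable one_ne_zero x)]
    rfl
  rw [h1, pderiv_comp_flip i hψ, ← mul_assoc, reflSign_mul_self, one_mul]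

theorem fold_of_mem {x : Euc (n + 1)} (hx : x ∈ halfBall n) : fold x = x := fold_of_pos hx.2.le

theorem fold_flip_of_mem {x : Euc (n + 1)} (hx : x ∈ halfBall n) : fold (flip n x) = x := by
  have h0 : 0 < x (Fin.last n) := hx.2
  rw [fold_of_neg (by rw [flip_last]; linarith), flip_flip]

/-- Up to the null hyperplane `x_d = 0`, the ball is the disjoint union of the half ball and its
mirror image, and the reflection preserves volume. -/
theorem setIntegral_unitBall_eq {F : Euc (n + 1) → ℝ}
    (hF : IntegrableOn F (unitBall (n + 1))) :
    ∫ x in unitBall (n + 1), F x = ∫ x in halfBall n, (F x + F (flip n x)) := by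
  have hpre : flip n ⁻¹' (flip n ⁻¹' halfBall n) = halfBall n := by
    ext x
    simp [flip_flip]
  have hmp := (flip n).measurePreserving
  have hemb := (flip n).toHomeomorph.measurableEmbedding
  have hsub : flip n ⁻¹' halfBall n ⊆ unitBall (n + 1) := fun x hx => by
    simpa using halfBall_subset hx
  have hi1 : IntegrableOn F (halfBall n) := hF.mono_set halfBall_subset
  have hi2 : IntegrableOn F (flip n ⁻¹' halfBall n) := hF.mono_set hsub
  have hi3 : IntegrableOn (fun x => F (flip n x)) (halfBall n) := by
    have := (hmp.integrableOn_comp_preimage hemb).2 hi2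
    rwa [hpre] at this
  have hdisj : Disjoint (halfBall n) (flip n ⁻¹' halfBall n) := by
    refine Set.disjoint_left.2 fun x hx hx' => ?_
    have h1 : 0 < x (Fin.last n) := hx.2
    have h2 : 0 < flip n x (Fin.last n) := hx'.2
    rw [flip_last] at h2
    linarith
  have hmeas : MeasurableSet (flip n ⁻¹' halfBall n) :=
    (flip n).continuous.measurable measurableSet_halfBall
  have hae : (unitBall (n + 1) : Set (Euc (n + 1))) =ᵐ[volume]
      (halfBall n ∪ flip n ⁻¹' halfBall n : Set (Euc (n + 1))) := by
    filter_upwards [ae_last_ne_zero] with x hx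
    refine propext ⟨fun hb => ?_, fun hb => hb.elim (fun h => halfBall_subset h) fun h => hsub h⟩
    rcases lt_or_gt_of_ne hx with h | h
    · refine Or.inr ⟨?_, ?_⟩
      · have : x ∈ unitBall (n + 1) := hb
        simpa using this
      · change 0 < flip n x (Fin.last n)
        rw [flip_last]
        linarith
    · exact Or.inl ⟨hb, h⟩
  rw [setIntegral_congr_set hae, setIntegral_union hdisj hmeas hi1 hi2, integral_add hi1 hi3,
    ← hmp.setIntegral_preimage_emb hemb F (flip n ⁻¹' halfBall n), hpre]

theorem setIntegral_unitBall_mul_eq {F G : Euc (n + 1) → ℝ}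
    (hF : MemLp F 2 (volume.restrict (unitBall (n + 1))))
    (hG : MemLp G 2 (volume.restrict (unitBall (n + 1)))) :
    ∫ x in unitBall (n + 1), F x * G x =
      ∫ x in halfBall n, (F x * G x + F (flip n x) * G (flip n x)) :=
  setIntegral_unitBall_eq (hF.integrable_mul hG)

/-- The function `w(x', |x_d|)` on `B_1`, multiplied by the sign of the coordinate `i` under
reflection in the part `x_d < 0`. -/
def reflFun (i : Fin (n + 1)) (w : L2 (halfBall n)) (x : Euc (n + 1)) : ℝ :=
  (if x (Fin.last n) < 0 then reflSign i else 1) * w (fold x)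

theorem reflFun_of_mem (i : Fin (n + 1)) (w : L2 (halfBall n)) {x : Euc (n + 1)}
    (hx : x ∈ halfBall n) : reflFun i w x = w x := by
  have h0 : 0 < x (Fin.last n) := hx.2
  rw [reflFun, if_neg h0.not_gt, one_mul, fold_of_mem hx]

theorem reflFun_flip_of_mem (i : Fin (n + 1)) (w : L2 (halfBall n)) {x : Euc (n + 1)}
    (hx : x ∈ halfBall n) : reflFun i w (flip n x) = reflSign i * w x := by
  have h0 : 0 < x (Fin.last n) := hx.2
  rw [reflFun, if_pos (by rw [flip_last]; linarith), fold_flip_of_mem hx]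

theorem memLp_reflFun (i : Fin (n + 1)) (w : L2 (halfBall n)) :
    MemLp (reflFun i w) 2 (volume.restrict (unitBall (n + 1))) := by
  have h := memLp_comp_fold w
  refine h.of_le (AEStronglyMeasurable.mul ?_ h.1) (Eventually.of_forall fun x => ?_)
  · exact (Measurable.ite (measurableSet_lt (by fun_prop) measurable_const) measurable_const
      measurable_const).aestronglyMeasurable
  · rw [reflFun, norm_mul]
    refine mul_le_of_le_one_left (norm_nonneg _) ?_
    unfold reflSign
    split_ifs <;> norm_num

theorem coeFn_evenExt (u : L2 (halfBall n)) :
    evenExt u =ᵐ[volume.restrict (unitBall (n + 1))] fun x => u (fold x) :=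
  (memLp_comp_fold u).coeFn_toLp

/-- In the direction `x_d` the combination is odd, so it vanishes on `B₁'` and kills the boundary
term; tangential directions have none. Hence no singular part appears on the interface when `u` is
extended evenly. -/
theorem HasFlatTrace.inner_pderiv_reflection {u : L2 (halfBall n)} {t : L2 (unitBall n)}
    (h : HasFlatTrace u t) (i : Fin (n + 1)) {ψ : Euc (n + 1) → ℝ}
    (hψ : IsTest (unitBall (n + 1)) ψ) :
    inner ℝ u (toL2 (halfBall n) (pderiv i (fun x => ψ x + reflSign i * ψ (flip n x)))) =
      - inner ℝ (weakPartial i u)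
        (toL2 (halfBall n) (fun x => ψ x + reflSign i * ψ (flip n x))) := by
  have ht := hψ.add_smul_comp_flip (reflSign i)
  induction i using Fin.lastCases with
  | last =>
    have h1 := h.inner_pderiv_last_add ht
    have h0 : (fun y : Euc n => ψ (flatIncl y) + reflSign (Fin.last n) *
        ψ (flip n (flatIncl y))) = fun _ => 0 := by
      funext y
      simp [flip_flatIncl, reflSign]
    rw [h0, inner_toL2 t (MemLp.zero' : MemLp (fun _ : Euc n => (0 : ℝ)) 2 _)] at h1
    simp only [mul_zero, integral_zero, neg_zero] at h1
    linarith
  | cast i => exact (isWeakPartial_weakPartial h.1 _).inner_pderiv_castSucc ht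

/-- The even extension of an `H¹` function is in `H¹`. -/
theorem HasFlatTrace.isWeakPartial_evenExt {u : L2 (halfBall n)} {t : L2 (unitBall n)}
    (h : HasFlatTrace u t) (i : Fin (n + 1)) :
    IsWeakPartial i (evenExt u) (toL2 (unitBall (n + 1)) (reflFun i (weakPartial i u))) := by
  intro ψ hψ
  have ht := hψ.add_smul_comp_flip (reflSign i)
  have key := h.inner_pderiv_reflection i hψ
  rw [inner_toL2 _ (ht.memLp_pderiv i), inner_toL2 _ ht.memLp] at key
  have e1 : ∫ x in unitBall (n + 1), evenExt u x * pderiv i ψ x =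
      ∫ x in unitBall (n + 1), u (fold x) * pderiv i ψ x := by
    refine integral_congr_ae ?_
    filter_upwards [coeFn_evenExt u] with x hx
    rw [hx]
  have e2 : ∫ x in unitBall (n + 1),
      toL2 (unitBall (n + 1)) (reflFun i (weakPartial i u)) x * ψ x =
      ∫ x in unitBall (n + 1), reflFun i (weakPartial i u) x * ψ x := by
    refine integral_congr_ae ?_
    filter_upwards [coeFn_toL2 (memLp_reflFun i (weakPartial i u))] with x hx
    rw [hx]
  -- Folding both integrals onto the half ball collects `ψ` and its reflection into the combination
  -- treated by `key`.
  rw [e1, e2, setIntegral_unitBall_mul_eq (memLp_comp_fold u) (hψ.memLp_pderiv i),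
    setIntegral_unitBall_mul_eq (memLp_reflFun i (weakPartial i u)) hψ.memLp]
  refine Eq.trans ?_ (key.trans ?_)
  · refine setIntegral_congr_fun measurableSet_halfBall fun x hx => ?_
    simp only [fold_of_mem hx, fold_flip_of_mem hx, pderiv_add_smul_comp_flip i hψ.contDiff_one]
    ring
  · refine congrArg Neg.neg (setIntegral_congr_fun measurableSet_halfBall fun x hx => ?_)
    simp only [reflFun_of_mem i _ hx, reflFun_flip_of_mem i _ hx]
    ring

theorem HasFlatTrace.weakPartial_evenExt {u : L2 (halfBall n)} {t : L2 (unitBall n)}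
    (h : HasFlatTrace u t) (i : Fin (n + 1)) :
    weakPartial i (evenExt u) =ᵐ[volume.restrict (unitBall (n + 1))]
      reflFun i (weakPartial i u) := by
  rw [(h.isWeakPartial_evenExt i).weakPartial_eq Metric.isOpen_ball]
  exact coeFn_toL2 (memLp_reflFun i _)

/-- The thin-obstacle energy is the full Dirichlet integral on the half ball. -/
theorem HasFlatTrace.energy_eq {u : L2 (halfBall n)} {t : L2 (unitBall n)}
    (h : HasFlatTrace u t) : energy u = ∑ i, ‖weakPartial i u‖ ^ 2 := by
  -- Squaring removes the reflection sign, so the halves contribute equally; this 2 cancels the 1/2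
  -- in `dirichlet`.
  have e1 : ∀ i, ∫ x in unitBall (n + 1), (weakPartial i (evenExt u) x) ^ 2 =
      2 * ‖weakPartial i u‖ ^ 2 := by
    intro i
    have hm := memLp_reflFun i (weakPartial i u)
    have : ∫ x in unitBall (n + 1), (weakPartial i (evenExt u) x) ^ 2 =
        ∫ x in unitBall (n + 1), reflFun i (weakPartial i u) x * reflFun i (weakPartial i u) x := by
      refine integral_congr_ae ?_
      filter_upwards [h.weakPartial_evenExt i] with x hx
      rw [hx, sq]
    rw [this, setIntegral_unitBall_mul_eq hm hm, ← real_inner_self_eq_norm_sq,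
      inner_L2, ← integral_const_mul]
    refine setIntegral_congr_fun measurableSet_halfBall fun x hx => ?_
    simp only [reflFun_of_mem i _ hx, reflFun_flip_of_mem i _ hx]
    linear_combination (weakPartial i u x) ^ 2 * reflSign_mul_self i
  rw [energy, dirichlet, integral_finsetSum _ fun i _ => (Lp.memLp _).integrable_sq,
    Finset.sum_congr rfl fun i _ => e1 i, ← Finset.mul_sum]
  ring

/-- Convergence in `H¹(B_1)` to the even extension implies convergence in `H¹(B_1^+)`. -/
theorem HasFlatTrace.tendstoH1_of_evenExt {u : L2 (halfBall n)} {t : L2 (unitBall n)}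
    (h : HasFlatTrace u t) {f : ℕ → Euc (n + 1) → ℝ} (hf : TendstoH1 f (evenExt u)) :
    TendstoH1 f u := by
  have hle : volume.restrict (halfBall n) ≤ volume.restrict (unitBall (n + 1)) :=
    Measure.restrict_mono halfBall_subset le_rfl
  have gen : ∀ (F : ℕ → Euc (n + 1) → ℝ) (v : Euc (n + 1) → ℝ) (w : Euc (n + 1) → ℝ),
      v =ᵐ[volume.restrict (halfBall n)] w →
      Tendsto (fun k => eLpNorm (fun x => F k x - v x) 2 (volume.restrict (unitBall (n + 1))))
        atTop (𝓝 0) →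
      Tendsto (fun k => eLpNorm (fun x => F k x - w x) 2 (volume.restrict (halfBall n)))
        atTop (𝓝 0) := by
    intro F v w hvw hF
    refine tendsto_of_tendsto_of_tendsto_of_le_of_le tendsto_const_nhds hF
      (fun _ => zero_le) fun k => ?_
    refine (eLpNorm_congr_ae ?_).trans_le (eLpNorm_mono_measure _ hle)
    filter_upwards [hvw] with x hx
    rw [hx]
  refine ⟨gen f _ _ ?_ hf.1, fun i => gen (fun k => pderiv i (f k)) _ _ ?_ (hf.2 i)⟩
  · filter_upwards [ae_mono hle (coeFn_evenExt u), ae_restrict_mem measurableSet_halfBall]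
      with x hx hx'
    rw [hx, fold_of_mem hx']
  · filter_upwards [ae_mono hle (h.weakPartial_evenExt i), ae_restrict_mem measurableSet_halfBall]
      with x hx hx'
    rw [hx, reflFun_of_mem i _ hx']

end Reflection

/-! ### Trace and Poincaré inequalities, and limits of boundary values. -/

section Inequalities

variable {n : ℕ}

theorem memLp_comp_flatIncl {f : Euc (n + 1) → ℝ} (hf : Continuous f) :
    MemLp (fun y => f (flatIncl y)) 2 (volume.restrict (unitBall n)) :=
  memLp_of_continuous le_rfl (hf.comp contDiff_flatIncl.continuous)

/-- The trace inequality for test functions of the unit ball. -/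
theorem IsTest.norm_flat_sq_le {ψ : Euc (n + 1) → ℝ} (hψ : IsTest (unitBall (n + 1)) ψ) :
    ‖toL2 (unitBall n) (fun y => ψ (flatIncl y))‖ ^ 2 ≤
      2 * (‖toL2 (halfBall n) ψ‖ * ‖toL2 (halfBall n) (pderiv (Fin.last n) ψ)‖) := by
  -- Taking both factors equal to `ψ` gives `2⟨ψ, ∂ψ/∂x_d⟩ = -‖ψ|_{B₁'}‖²`.
  have h := inner_pderiv_last_add hψ.1 hψ
  have h' := neg_le_of_abs_le (abs_real_inner_le_norm (toL2 (halfBall n) ψ)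
    (toL2 (halfBall n) (pderiv (Fin.last n) ψ)))
  rw [real_inner_self_eq_norm_sq, real_inner_comm (toL2 (halfBall n) ψ)] at h
  linarith

/-- The Poincaré inequality for test functions of the unit ball. -/
theorem IsTest.norm_le {ψ : Euc (n + 1) → ℝ} (hψ : IsTest (unitBall (n + 1)) ψ) :
    ‖toL2 (halfBall n) ψ‖ ≤ 2 * ‖toL2 (halfBall n) (pderiv (Fin.last n) ψ)‖ := by
  have hl : ContDiff ℝ ∞ (fun x : Euc (n + 1) => x (Fin.last n)) := by fun_prop
  have hl1 : ContDiff ℝ 1 (fun x : Euc (n + 1) => x (Fin.last n)) := by fun_prop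
  have hd : pderiv (Fin.last n) (fun x : Euc (n + 1) => x (Fin.last n) * ψ x) =
      fun x => x (Fin.last n) * pderiv (Fin.last n) ψ x + ψ x := by
    funext x
    rw [pderiv_mul _ hl1 hψ.contDiff_one]
    have h1 : pderiv (Fin.last n) (fun x : Euc (n + 1) => x (Fin.last n)) x = 1 := by
      have := (EuclideanSpace.proj (Fin.last n) : Euc (n + 1) →L[ℝ] ℝ).fderiv (x := x)
      change fderiv ℝ (EuclideanSpace.proj (Fin.last n) : Euc (n + 1) →L[ℝ] ℝ) x _ = 1
      rw [this]
      simp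
    rw [h1, one_mul]
  have m1 : MemLp ψ 2 (volume.restrict (halfBall n)) := hψ.memLp
  have m2 : MemLp (pderiv (Fin.last n) ψ) 2 (volume.restrict (halfBall n)) := hψ.memLp_pderiv _
  have m3 : MemLp (fun x => x (Fin.last n) * ψ x) 2 (volume.restrict (halfBall n)) :=
    memLp_of_continuous halfBall_subset (hl.continuous.mul hψ.1.continuous)
  have m4 : MemLp (fun x => x (Fin.last n) * pderiv (Fin.last n) ψ x) 2
      (volume.restrict (halfBall n)) :=
    memLp_of_continuous halfBall_subset
      (hl.continuous.mul (continuous_pderiv _ hψ.contDiff_one))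
  -- The weight `x_d` removes the boundary term and leaves `‖ψ‖² = -2⟨x_d ψ, ∂ψ/∂x_d⟩`; since `|x_d|
  -- ≤ 1`, the Poincaré constant is 2.
  have h := inner_pderiv_last_add (hl.mul hψ.1) hψ
  have h0 : (fun y : Euc n => flatIncl y (Fin.last n) * ψ (flatIncl y)) = fun _ => 0 := by
    funext y
    simp
  rw [h0, hd, real_inner_comm (toL2 (unitBall n) fun y => ψ (flatIncl y)),
    inner_toL2 _ (MemLp.zero' : MemLp (fun _ : Euc n => (0 : ℝ)) 2 _)] at h
  simp only [mul_zero, integral_zero, neg_zero] at h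
  have h2 : inner ℝ (toL2 (halfBall n)
      (fun x => x (Fin.last n) * pderiv (Fin.last n) ψ x + ψ x)) (toL2 (halfBall n) ψ) =
      inner ℝ (toL2 (halfBall n) fun x => x (Fin.last n) * ψ x)
        (toL2 (halfBall n) (pderiv (Fin.last n) ψ)) + ‖toL2 (halfBall n) ψ‖ ^ 2 := by
    have m5 : MemLp (fun x => x (Fin.last n) * pderiv (Fin.last n) ψ x + ψ x) 2
        (volume.restrict (halfBall n)) := m4.add m1
    rw [← real_inner_self_eq_norm_sq, inner_toL2_toL2 m5 m1, inner_toL2_toL2 m3 m2,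
      inner_toL2_toL2 m1 m1]
    refine Eq.trans ?_ (integral_add (m3.integrable_mul m2) (m1.integrable_mul m1))
    refine integral_congr_ae (Eventually.of_forall fun x => ?_)
    change _ = x (Fin.last n) * ψ x * pderiv (Fin.last n) ψ x + ψ x * ψ x
    ring
  have h3 : ‖toL2 (halfBall n) fun x => x (Fin.last n) * ψ x‖ ≤ ‖toL2 (halfBall n) ψ‖ := by
    refine Lp.norm_le_norm_of_ae_le ?_
    filter_upwards [coeFn_toL2 m3, coeFn_toL2 m1, ae_restrict_mem measurableSet_halfBall]
      with x h1 h2 hx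
    rw [h1, h2, norm_mul]
    refine mul_le_of_le_one_left (norm_nonneg _) ((PiLp.norm_apply_le x _).trans ?_)
    simpa using (mem_ball_zero_iff.1 hx.1).le
  have h4 := neg_le_of_abs_le (abs_real_inner_le_norm
    (toL2 (halfBall n) fun x => x (Fin.last n) * ψ x)
    (toL2 (halfBall n) (pderiv (Fin.last n) ψ)))
  have h5 := mul_le_mul_of_nonneg_right h3
    (norm_nonneg (toL2 (halfBall n) (pderiv (Fin.last n) ψ)))
  rw [h2] at h
  rcases (norm_nonneg (toL2 (halfBall n) ψ)).eq_or_lt with h6 | h6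
  · rw [← h6]
    positivity
  · refine le_of_mul_le_mul_left ?_ h6
    nlinarith

/-- Test functions of `B_1'` are restrictions of test functions of `B_1`. -/
theorem IsTest.exists_extension {ζ : Euc n → ℝ} (hζ : IsTest (unitBall n) ζ) :
    ∃ ψ, IsTest (unitBall (n + 1)) ψ ∧ ∀ y, ψ (flatIncl y) = ζ y := by
  obtain ⟨r, ⟨hr0, hr1⟩, hr⟩ := exists_pos_lt_subset_ball one_pos (isClosed_tsupport ζ) hζ.2.2
  -- The extension is `ζ(x') η(x_d)`. With `ζ` supported in radius `< r` and `η` in `|x_d| ≤ 1 - r`,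
  -- the triangle inequality keeps the support inside the open ball.
  let η : ContDiffBump (0 : ℝ) := ⟨(1 - r) / 2, 1 - r, by linarith, by linarith⟩
  let p : Euc (n + 1) → Euc n := fun x => WithLp.toLp 2 fun j => x j.castSucc
  have hp : ContDiff ℝ ∞ p := by
    rw [contDiff_euclidean]
    intro j
    change ContDiff ℝ ∞ fun x : Euc (n + 1) => x j.castSucc
    fun_prop
  have hq : ContDiff ℝ ∞ fun x : Euc (n + 1) => x (Fin.last n) := by fun_prop
  have hsub : tsupport (fun x => ζ (p x) * η (x (Fin.last n))) ⊆ unitBall (n + 1) := by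
    have hcl : IsClosed (p ⁻¹' tsupport ζ ∩
        (fun x : Euc (n + 1) => x (Fin.last n)) ⁻¹' Metric.closedBall 0 (1 - r)) :=
      ((isClosed_tsupport ζ).preimage hp.continuous).inter
        (Metric.isClosed_closedBall.preimage hq.continuous)
    refine (closure_minimal (fun x hx => ?_) hcl).trans fun x hx => ?_
    · have h1 : p x ∈ Function.support ζ := left_ne_zero_of_mul hx
      have h2 : x (Fin.last n) ∈ Function.support η := right_ne_zero_of_mul hx
      rw [η.support_eq] at h2
      exact ⟨subset_tsupport ζ h1, Metric.ball_subset_closedBall h2⟩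
    · have h1 : ‖p x‖ < r := by simpa using hr hx.1
      have h2 : ‖x (Fin.last n)‖ ≤ 1 - r := by simpa using hx.2
      have hx : x = flatIncl (p x) +
          x (Fin.last n) • EuclideanSpace.single (Fin.last n) (1 : ℝ) := by
        ext j
        induction j using Fin.lastCases with
        | last => simp
        | cast j => simp [p]
      rw [mem_ball_zero_iff, hx]
      refine (norm_add_le _ _).trans_lt ?_
      rw [norm_flatIncl, norm_smul, PiLp.norm_single, norm_one, mul_one]
      linarith
  refine ⟨fun x => ζ (p x) * η (x (Fin.last n)), ⟨?_, ?_, hsub⟩, fun y => ?_⟩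
  · exact (hζ.1.comp hp).mul (η.contDiff.comp hq)
  · exact (isCompact_closedBall (0 : Euc (n + 1)) 1).of_isClosed_subset (isClosed_tsupport _)
      (hsub.trans Metric.ball_subset_closedBall)
  · have h1 : p (flatIncl y) = y := by
      ext j
      simp [p]
    have h2 : η 0 = 1 := η.one_of_mem_closedBall (by simp [η]; linarith)
    simp [h1, h2]

/-- If test functions of `B_1` converge in `H¹(B_1^+)`, their restrictions to `B_1'` converge to
the trace of the limit. -/
theorem HasFlatTrace.tendsto_flat {w : L2 (halfBall n)} {t : L2 (unitBall n)}
    (hw : HasFlatTrace w t) {f : ℕ → Euc (n + 1) → ℝ}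
    (hf : ∀ k, IsTest (unitBall (n + 1)) (f k)) (hfw : TendstoH1 f w) :
    Tendsto (fun k => toL2 (unitBall n) fun y => f k (flatIncl y)) atTop (𝓝 t) := by
  have ha := hfw.tendsto_toL2 halfBall_subset fun k => (hf k).1
  have hb := hfw.tendsto_toL2_pderiv halfBall_subset (fun k => (hf k).1) (Fin.last n)
  -- The trace inequality for `f k - f l`, with `2ab ≤ (a + b)²`, makes the boundary values Cauchy.
  have hdist : ∀ k l, dist (toL2 (unitBall n) fun y => f k (flatIncl y))
      (toL2 (unitBall n) fun y => f l (flatIncl y)) ≤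
      dist (toL2 (halfBall n) (f k)) (toL2 (halfBall n) (f l)) +
      dist (toL2 (halfBall n) (pderiv (Fin.last n) (f k)))
        (toL2 (halfBall n) (pderiv (Fin.last n) (f l))) := by
    intro k l
    have h := ((hf k).sub (hf l)).norm_flat_sq_le
    rw [toL2_sub (memLp_comp_flatIncl (hf k).1.continuous)
      (memLp_comp_flatIncl (hf l).1.continuous), toL2_sub (hf k).memLp (hf l).memLp,
      pderiv_sub _ (hf k).contDiff_one (hf l).contDiff_one,
      toL2_sub ((hf k).memLp_pderiv _) ((hf l).memLp_pderiv _)] at h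
    rw [dist_eq_norm, dist_eq_norm, dist_eq_norm]
    refine le_of_sq_le_sq ?_ (by positivity)
    nlinarith [sq_nonneg ‖toL2 (halfBall n) (f k) - toL2 (halfBall n) (f l)‖,
      sq_nonneg ‖toL2 (halfBall n) (pderiv (Fin.last n) (f k)) -
        toL2 (halfBall n) (pderiv (Fin.last n) (f l))‖]
  have hc : CauchySeq fun k => toL2 (unitBall n) fun y => f k (flatIncl y) := by
    rw [Metric.cauchySeq_iff]
    intro ε hε
    obtain ⟨N, hN⟩ := Metric.cauchySeq_iff.1 ha.cauchySeq (ε / 2) (half_pos hε)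
    obtain ⟨N', hN'⟩ := Metric.cauchySeq_iff.1 hb.cauchySeq (ε / 2) (half_pos hε)
    refine ⟨max N N', fun k hk l hl => (hdist k l).trans_lt ?_⟩
    have h1 := hN k (le_of_max_le_left hk) l (le_of_max_le_left hl)
    have h2 := hN' k (le_of_max_le_right hk) l (le_of_max_le_right hl)
    linarith
  obtain ⟨τ, hτ⟩ := cauchySeq_tendsto_of_complete hc
  -- The sequence defining `t` may differ from `f`, so the limit is identified by duality:
  -- integration by parts gives `τ` and `t` the same pairing with every test function of `B₁'`, each
  -- being the restriction of one of `B₁`.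
  suffices h : τ - t = 0 by rwa [← sub_eq_zero.1 h]
  refine ae_eq_zero_of_forall_isTest Metric.isOpen_ball _ fun ζ hζ => ?_
  obtain ⟨ψ, hψ, hψζ⟩ := hζ.exists_extension
  obtain rfl : (fun y => ψ (flatIncl y)) = ζ := funext hψζ
  rw [← inner_toL2 _ (memLp_comp_flatIncl hψ.1.continuous), inner_sub_left, sub_eq_zero,
    ← neg_inj, ← hw.inner_pderiv_last_add hψ]
  refine tendsto_nhds_unique (hτ.inner tendsto_const_nhds).neg
    (((ha.inner (tendsto_const_nhds (x := toL2 (halfBall n) (pderiv (Fin.last n) ψ)))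
      (𝕜 := ℝ)).add (hb.inner (tendsto_const_nhds (x := toL2 (halfBall n) ψ))
        (𝕜 := ℝ))).congr fun k => ?_)
  exact ThinObstacle.inner_pderiv_last_add (hf k).1 hψ

theorem tendsto_eLpNorm_sub {m : ℕ} {Ω : Set (Euc m)} {a b : L2 Ω} {F G : ℕ → Euc m → ℝ}
    (hF : ∀ k, Continuous (F k)) (hG : ∀ k, Continuous (G k))
    (ha : Tendsto (fun k => eLpNorm (fun x => F k x - a x) 2 (volume.restrict Ω)) atTop (𝓝 0))
    (hb : Tendsto (fun k => eLpNorm (fun x => G k x - b x) 2 (volume.restrict Ω)) atTop (𝓝 0)) :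
    Tendsto (fun k => eLpNorm (fun x => F k x - G k x - (a - b : L2 Ω) x) 2
      (volume.restrict Ω)) atTop (𝓝 0) := by
  have h := ha.add hb
  rw [add_zero] at h
  refine tendsto_of_tendsto_of_tendsto_of_le_of_le tendsto_const_nhds h
    (fun _ => zero_le) fun k => ?_
  refine (eLpNorm_congr_ae ?_).trans_le (eLpNorm_sub_le
    ((hF k).aestronglyMeasurable.sub (Lp.aestronglyMeasurable a))
    ((hG k).aestronglyMeasurable.sub (Lp.aestronglyMeasurable b)) (by norm_num))
  filter_upwards [Lp.coeFn_sub a b] with x hx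
  simp only [hx, Pi.sub_apply]
  ring

theorem TendstoH1.sub {m : ℕ} {Ω : Set (Euc m)} (hΩ : IsOpen Ω) {u v : L2 Ω}
    {f g : ℕ → Euc m → ℝ} (hu : MemH1 u) (hv : MemH1 v) (hf : ∀ k, ContDiff ℝ ∞ (f k))
    (hg : ∀ k, ContDiff ℝ ∞ (g k)) (hfu : TendstoH1 f u) (hgv : TendstoH1 g v) :
    TendstoH1 (fun k x => f k x - g k x) (u - v) := by
  have hf1 : ∀ k, ContDiff ℝ 1 (f k) := fun k => (hf k).of_le (by norm_num)
  have hg1 : ∀ k, ContDiff ℝ 1 (g k) := fun k => (hg k).of_le (by norm_num)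
  refine ⟨tendsto_eLpNorm_sub (fun k => (hf k).continuous) (fun k => (hg k).continuous)
    hfu.1 hgv.1, fun i => ?_⟩
  rw [weakPartial_sub hΩ hu hv]
  simp only [pderiv_sub _ (hf1 _) (hg1 _)]
  exact tendsto_eLpNorm_sub (fun k => continuous_pderiv i (hf1 k))
    (fun k => continuous_pderiv i (hg1 k)) (hfu.2 i) (hgv.2 i)

theorem HasFlatTrace.sub {u v : L2 (halfBall n)} {t s : L2 (unitBall n)}
    (hu : HasFlatTrace u t) (hv : HasFlatTrace v s) : HasFlatTrace (u - v) (t - s) := by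
  obtain ⟨hu1, f, hf, hfu, hft⟩ := hu
  obtain ⟨hv1, g, hg, hgv, hgs⟩ := hv
  exact ⟨hu1.sub hv1, fun k x => f k x - g k x, fun k => (hf k).sub (hg k),
    hfu.sub isOpen_halfBall hu1 hv1 hf hg hgv,
    tendsto_eLpNorm_sub (fun k => (hf k).continuous.comp contDiff_flatIncl.continuous)
      (fun k => (hg k).continuous.comp contDiff_flatIncl.continuous) hft hgs⟩

/-- The difference of two admissible functions is a limit in `H¹(B_1^+)` of test functions
of `B_1`. -/
theorem exists_isTest_tendstoH1_sub {g u v : L2 (halfBall n)} (hg : FlatNonneg g)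
    (hu : u ∈ admissible g) (hv : v ∈ admissible g) :
    ∃ f : ℕ → Euc (n + 1) → ℝ, (∀ k, IsTest (unitBall (n + 1)) (f k)) ∧ TendstoH1 f (v - u) := by
  obtain ⟨_, hg, -⟩ := hg
  obtain ⟨-, ⟨_, hu, -⟩, -, a, ha, hau⟩ := hu
  obtain ⟨-, ⟨_, hv, -⟩, -, b, hb, hbv⟩ := hv
  refine ⟨fun k x => b k x - a k x, fun k => (hb k).sub (ha k), ?_⟩
  -- Write `v - u = (v - g) - (u - g)`; the even extensions of both terms lie in `H¹₀(B₁)`.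
  rw [← sub_sub_sub_cancel_right v u g]
  exact ((hv.sub hg).tendstoH1_of_evenExt hbv).sub isOpen_halfBall (hv.sub hg).1 (hu.sub hg).1
    (fun k => (hb k).1) (fun k => (ha k).1) ((hu.sub hg).tendstoH1_of_evenExt hau)

/-! ### Green's formula with boundary term, and the energy gap. -/

/-- Green's formula on the half ball, with test functions that vanish near `∂B_1` only. -/
theorem MemH2.sum_inner_pderiv {u : L2 (halfBall n)} {s : L2 (unitBall n)} (hu : MemH2 u)
    (hs : HasFlatTrace (weakPartial (Fin.last n) u) s) {ψ : Euc (n + 1) → ℝ}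
    (hψ : IsTest (unitBall (n + 1)) ψ) :
    ∑ i, inner ℝ (weakPartial i u) (toL2 (halfBall n) (pderiv i ψ)) =
      - inner ℝ (laplacian u) (toL2 (halfBall n) ψ) -
        inner ℝ s (toL2 (unitBall n) fun y => ψ (flatIncl y)) := by
  rw [laplacian, sum_inner, Fin.sum_univ_castSucc, Fin.sum_univ_castSucc]
  have h1 : ∀ i : Fin n, inner ℝ (weakPartial i.castSucc u)
      (toL2 (halfBall n) (pderiv i.castSucc ψ)) =
      - inner ℝ (weakPartial i.castSucc (weakPartial i.castSucc u)) (toL2 (halfBall n) ψ) :=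
    fun i => (isWeakPartial_weakPartial (hu.2 _) _).inner_pderiv_castSucc hψ
  rw [Finset.sum_congr rfl fun i _ => h1 i, Finset.sum_neg_distrib]
  linarith [hs.inner_pderiv_last_add hψ]

/-- By Cauchy–Schwarz the quotients are bounded by `‖G‖`, so the real `sSup` is a true supremum
rather than the default value 0. -/
theorem neg_inner_le_constrainedNorm_mul {H : Type*} [NormedAddCommGroup H]
    [InnerProductSpace ℝ H] {K : Set H} {u v : H} (G : H) (hv : v ∈ K) :
    - inner ℝ (v - u) G ≤ constrainedNorm K u G * ‖v - u‖ := by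
  rcases eq_or_ne v u with rfl | hne
  · simp
  have hpos : 0 < ‖v - u‖ := norm_pos_iff.2 (sub_ne_zero.2 hne)
  rw [← div_le_iff₀ hpos]
  refine le_csSup ⟨‖G‖, ?_⟩ (Or.inr ⟨v, ⟨hv, hne⟩, rfl⟩)
  rintro r (rfl | ⟨z, hz, rfl⟩)
  · exact norm_nonneg G
  · have hz' : 0 < ‖z - u‖ := norm_pos_iff.2 (sub_ne_zero.2 hz.2)
    rw [div_le_iff₀ hz', mul_comm]
    exact (neg_le_abs _).trans (abs_real_inner_le_norm _ _)

theorem constrainedNorm_nonneg {H : Type*} [NormedAddCommGroup H]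
    [InnerProductSpace ℝ H] (K : Set H) (u G : H) : 0 ≤ constrainedNorm K u G := by
  exact Real.sSup_nonneg' ⟨0, Or.inl rfl, le_rfl⟩

/-- The energy gap to any admissible competitor is controlled by the constrained norm of the
gradient. -/
theorem energy_sub_le {g u v : L2 (halfBall n)} (hg : FlatNonneg g) (hu2 : MemH2 u)
    (hu : u ∈ admissible g) (hS : Signorini u) (hv : v ∈ admissible g) :
    energy u - energy v ≤ (2 * constrainedNorm (admissible g) u (gradEnergy u)) ^ 2 := by
  obtain ⟨t, s, ht, hs, hs0, hts⟩ := hS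
  obtain ⟨f, hf, hfw⟩ := exists_isTest_tendstoH1_sub hg hu hv
  obtain ⟨hv1, ⟨tv, htv, htv0⟩, -⟩ := id hv
  have hf' : ∀ k, ContDiff ℝ ∞ (f k) := fun k => (hf k).1
  have hw := htv.sub ht
  have l0 := hfw.tendsto_toL2 halfBall_subset hf'
  have l1 := hfw.tendsto_toL2_pderiv halfBall_subset hf'
  have l2 := hw.tendsto_flat hf hfw
  have green : ∑ i, inner ℝ (weakPartial i u) (weakPartial i (v - u)) =
      - inner ℝ (laplacian u) (v - u) - inner ℝ s (tv - t) := by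
    refine tendsto_nhds_unique (tendsto_finsetSum _ fun i _ =>
      (tendsto_const_nhds (x := weakPartial i u)).inner (l1 i)) ?_
    refine (((tendsto_const_nhds (x := laplacian u)).inner l0).neg.sub
      ((tendsto_const_nhds (x := s)).inner l2)).congr fun k => ?_
    exact (hu2.sum_inner_pderiv hs (hf k)).symm
  -- Complementarity `t s = 0` reduces the integrand to `s tv`, a product of opposite signs.
  have hbdry : inner ℝ s (tv - t) ≤ 0 := by
    rw [inner_L2]
    refine integral_nonpos_of_ae ?_
    filter_upwards [hs0, hts, htv0, Lp.coeFn_sub tv t] with y h1 h2 h3 h4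
    rw [h4, Pi.sub_apply, mul_sub, mul_comm (s y) (t y), h2, sub_zero]
    exact mul_nonpos_of_nonpos_of_nonneg h1 h3
  have poincare : ‖v - u‖ ≤ 2 * ‖weakPartial (Fin.last n) (v - u)‖ :=
    le_of_tendsto_of_tendsto' l0.norm ((l1 (Fin.last n)).norm.const_mul 2)
      fun k => (hf k).norm_le
  have henergy : energy v = energy u +
      2 * ∑ i, inner ℝ (weakPartial i u) (weakPartial i (v - u)) +
      ∑ i, ‖weakPartial i (v - u)‖ ^ 2 := by
    rw [htv.energy_eq, ht.energy_eq, Finset.mul_sum, ← Finset.sum_add_distrib,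
      ← Finset.sum_add_distrib]
    refine Finset.sum_congr rfl fun i _ => ?_
    rw [← norm_add_sq_real, weakPartial_sub isOpen_halfBall hv1 hu.1, add_sub_cancel]
  have hlast : ‖weakPartial (Fin.last n) (v - u)‖ ^ 2 ≤ ∑ i, ‖weakPartial i (v - u)‖ ^ 2 :=
    Finset.single_le_sum (f := fun i => ‖weakPartial i (v - u)‖ ^ 2)
      (fun i _ => sq_nonneg _) (Finset.mem_univ _)
  have hN := neg_inner_le_constrainedNorm_mul (K := admissible g) (u := u) (gradEnergy u) hv
  have hN0 := constrainedNorm_nonneg (admissible g) u (gradEnergy u)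
  have hG : inner ℝ (v - u) (gradEnergy u) = - inner ℝ (laplacian u) (v - u) := by
    rw [gradEnergy, inner_neg_right, real_inner_comm]
  have hP := mul_le_mul_of_nonneg_left poincare hN0
  -- Completing the square: with `a = ‖∂(v - u)/∂x_d‖`, the gap is at most `4Na - a² = 4N² - (a -
  -- 2N)²`.
  nlinarith [sq_nonneg (‖weakPartial (Fin.last n) (v - u)‖ -
    2 * constrainedNorm (admissible g) u (gradEnergy u))]

end Inequalities

end ThinObstacle

end

theorem proposition4p2 (n : ℕ) (hn : 1 ≤ n) :
    ∃ C : ℝ, 0 < C ∧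
      ∀ g φ : ThinObstacle.L2 (ThinObstacle.halfBall n),
        ThinObstacle.MemH1 g → ThinObstacle.FlatNonneg g → ThinObstacle.IsMinimizer g φ →
        ∀ u : ThinObstacle.L2 (ThinObstacle.halfBall n),
          ThinObstacle.MemH2 u → u ∈ ThinObstacle.admissible g → ThinObstacle.Signorini u →
          (ThinObstacle.energy u - ThinObstacle.energy φ) ^ (1 / 2 : ℝ) ≤
            C * ThinObstacle.constrainedNorm (ThinObstacle.admissible g) u
              (ThinObstacle.gradEnergy u) := by
  -- The constant 2 is the Poincaré constant of the half ball found above, so it does not even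
  -- depend on the dimension.
  refine ⟨2, two_pos, fun g φ _ hg hφ u hu2 hu hS => ?_⟩
  rw [← Real.sqrt_eq_rpow]
  exact Real.sqrt_le_iff.2 ⟨mul_nonneg two_pos.le (ThinObstacle.constrainedNorm_nonneg _ _ _),
    ThinObstacle.energy_sub_le hg hu2 hu hS hφ.1⟩
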